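/- **Definitions.** Let $M$ be a monoid. An *atom* of $M$ is an element $a\neq 1$ such that $a=bc$ implies $b=1$ or $c=1$. $M$ is *atomic* if it is generated by its atoms and, for every $a\in M$, the lengths of the expressions of $a$ as a product of atoms are bounded. Write $a\le_L b$ if $ac=b$ for some $c\in M$, and $a\le_R b$ if $ca=b$ for some $c\in M$. An atomic monoid $M$ is a *Garside monoid* if it is finitely generated, left and right cancellative, $(M,\le_L)$ and $(M,\le_R)$ are lattices, and there is a *Garside element*, that is, an element $\Delta\in M$ such that $\{b: b\le_L\Delta\}=\{b: b\le_R\Delta\}$ and this set generates $M$. A *Garside group* $G$ is the group of fractions of a Garside monoid $G^+\subseteq G$. For $g,h\in G$ write $g\le_L h$ if $g^{-1}h\in G^+$. Let $G$ be a nontrivial Garside group with positive monoid $G^+$, and fix a Garside element $\Delta$ of $G^+$. For $g\in G$ let $$\inf(g)=\max\{r\in\mathbb Z:\Delta^r\le_L g\},\qquad \sup(g)=\min\{s\in\mathbb Z: g\le_L\Delta^s\},$$ and, with $[g]$ the conjugacy class of $g$ in $G$, $$\inf\nolimits_s(g)=\max_{h\in[g]}\inf(h),\qquad \sup\nolimits_s(g)=\min_{h\in[g]}\sup(h),\qquad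 \operatorname{len}_s(g)=\sup\nolimits_s(g)-\inf\nolimits_s(g).$$ **Theorem.** For every $g\in G$ and every integer $n\ge 1$: 1. $\inf_s(g)\le \dfrac{\inf_s(g^n)}{n}<\inf_s(g)+1$; 2. $\sup_s(g)-1<\dfrac{\sup_s(g^n)}{n}\le\sup_s(g)$; 3. $\operatorname{len}_s(g)-2<\dfrac{\operatorname{len}_s(g^n)}{n}\le\operatorname{len}_s(g)$. -/

import Mathlib

namespace Garside

section Monoid

variable {M : Type*} [Monoid M]

/-- Atoms (indivisible elements) of a monoid. -/
def IsAtomElement (a : M) : Prop :=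
  a ≠ 1 ∧ ∀ b c : M, a = b * c → b = 1 ∨ c = 1

/-- The set of lengths of all expressions of `a` as a product of atoms. -/
def atomLengths (a : M) : Set ℕ :=
  {k | ∃ l : List M, (∀ x ∈ l, IsAtomElement x) ∧ l.prod = a ∧ l.length = k}

variable (M) in
/-- `M` is atomic: it is generated by its atoms, and for every `a` the supremum of the lengths
of the expressions of `a` in terms of atoms is finite. -/
def IsAtomic : Prop :=
  Submonoid.closure {a : M | IsAtomElement a} = ⊤ ∧ ∀ a : M, BddAbove (atomLengths a)

/-- `a ≤_L b` in the monoid. -/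
def LeDvdL (a b : M) : Prop := ∃ c : M, a * c = b

/-- `a ≤_R b` in the monoid. -/
def LeDvdR (a b : M) : Prop := ∃ c : M, c * a = b

/-- The relation `r` is a partial order in which any two elements have a greatest lower bound
and a least upper bound. -/
def IsLatticeRel {α : Type*} (r : α → α → Prop) : Prop :=
  (∀ a, r a a) ∧ (∀ a b c, r a b → r b c → r a c) ∧ (∀ a b, r a b → r b a → a = b) ∧
  (∀ a b, ∃ m, r m a ∧ r m b ∧ ∀ c, r c a → r c b → r c m) ∧
  (∀ a b, ∃ j, r a j ∧ r b j ∧ ∀ c, r a c → r b c → r j c)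

/-- `Δ` is a Garside element: its left and right divisors coincide and generate `M`. -/
def IsGarsideElement (Δ : M) : Prop :=
  {b : M | LeDvdL b Δ} = {b : M | LeDvdR b Δ} ∧
    Submonoid.closure {b : M | LeDvdL b Δ} = ⊤

variable (M) in
/-- Garside monoids. -/
structure IsGarsideMonoid : Prop where
  atomic : IsAtomic M
  fg : Monoid.FG M
  mul_left_cancel : ∀ a b c : M, a * b = a * c → b = c
  mul_right_cancel : ∀ a b c : M, b * a = c * a → b = c
  lattice_left : IsLatticeRel (LeDvdL (M := M))
  lattice_right : IsLatticeRel (LeDvdR (M := M))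
  exists_garside : ∃ Δ : M, IsGarsideElement Δ

end Monoid

section Group

variable {G : Type*} [Group G]

/-- `G` is a Garside group with positive monoid `P`: the submonoid `P` is a Garside monoid and
`G` is its group of fractions, i.e. every element of `G` is a quotient of elements of `P`. -/
structure IsGarsideGroup (P : Submonoid G) : Prop where
  garside : IsGarsideMonoid P
  fractions : ∀ g : G, ∃ a ∈ P, ∃ b ∈ P, g = a * b⁻¹

/-- The order `g ≤_L h` on the group `G` with positive monoid `P`. -/
def LeL (P : Submonoid G) (g h : G) : Prop := ∃ c ∈ P, g * c = h

/-- `inf g = max {r ∈ ℤ : Δ ^ r ≤_L g}`. -/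
noncomputable def inf (P : Submonoid G) (Δ : P) (g : G) : ℤ :=
  sSup {r : ℤ | LeL P ((Δ : G) ^ r) g}

/-- `sup g = min {s ∈ ℤ : g ≤_L Δ ^ s}`. -/
noncomputable def sup (P : Submonoid G) (Δ : P) (g : G) : ℤ :=
  sInf {s : ℤ | LeL P g ((Δ : G) ^ s)}

/-- `inf_s g`, the maximum of `inf` over the conjugacy class of `g`. -/
noncomputable def infS (P : Submonoid G) (Δ : P) (g : G) : ℤ :=
  sSup {r : ℤ | ∃ h : G, IsConj g h ∧ inf P Δ h = r}

/-- `sup_s g`, the minimum of `sup` over the conjugacy class of `g`. -/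
noncomputable def supS (P : Submonoid G) (Δ : P) (g : G) : ℤ :=
  sInf {s : ℤ | ∃ h : G, IsConj g h ∧ sup P Δ h = s}

/-- `len_s g = sup_s g - inf_s g`. -/
noncomputable def lenS (P : Submonoid G) (Δ : P) (g : G) : ℤ :=
  supS P Δ g - infS P Δ g

/-! In a nontrivial Garside group the maxima and minima above exist. -/

variable {P : Submonoid G} {Δ : P}

theorem conj_zpow_mem (hΔ : IsGarsideElement Δ) (k : ℤ) {p : G} (hp : p ∈ P) :
    (Δ : G) ^ (-k) * p * (Δ : G) ^ k ∈ P := by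
  have mem : ∀ b : P, LeDvdL b Δ ↔ LeDvdR b Δ := fun b => by
    have := hΔ.1
    exact Set.ext_iff.1 this b
  have key : ∀ q : P, (Δ : G)⁻¹ * q * Δ ∈ P ∧ (Δ : G) * q * (Δ : G)⁻¹ ∈ P := by
    intro q
    have hq : q ∈ Submonoid.closure {b : P | LeDvdL b Δ} := by rw [hΔ.2]; trivial
    induction hq using Submonoid.closure_induction with
    | mem s hs =>
      constructor
      · obtain ⟨t, ht⟩ := hs
        obtain ⟨u, hu⟩ := (mem t).2 ⟨s, ht⟩
        have ht' : (s : G) * t = Δ := by exact_mod_cast congrArg Subtype.val ht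
        have hu' : (t : G) * u = Δ := by exact_mod_cast congrArg Subtype.val hu
        have : (Δ : G)⁻¹ * s * Δ = u := by
          nth_rewrite 2 [← hu']
          rw [← ht']; group
        rw [this]; exact u.2
      · obtain ⟨t, ht⟩ := (mem s).1 hs
        obtain ⟨u, hu⟩ := (mem t).1 ⟨s, ht⟩
        have ht' : (t : G) * s = Δ := by exact_mod_cast congrArg Subtype.val ht
        have hu' : (u : G) * t = Δ := by exact_mod_cast congrArg Subtype.val hu
        have : (Δ : G) * s * (Δ : G)⁻¹ = u := by
          nth_rewrite 1 [← hu']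
          rw [← ht']; group
        rw [this]; exact u.2
    | one => simp [P.one_mem]
    | mul x y _ _ hx hy =>
      constructor
      · have := P.mul_mem hx.1 hy.1
        convert this using 1
        push_cast; group
      · have := P.mul_mem hx.2 hy.2
        convert this using 1
        push_cast; group
  induction k using Int.induction_on with
  | zero => simpa using hp
  | succ i ih =>
    have := (key ⟨_, ih⟩).1
    convert this using 1
    simp only [zpow_add, zpow_one, neg_add, zpow_neg]
    group
  | pred i ih =>
    have := (key ⟨_, ih⟩).2
    convert this using 1
    simp only [zpow_sub, zpow_one, neg_sub, zpow_neg]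
    group

theorem LeL.trans {a b c : G} (h : LeL P a b) (h' : LeL P b c) : LeL P a c := by
  obtain ⟨x, hx, rfl⟩ := h
  obtain ⟨y, hy, rfl⟩ := h'
  exact ⟨x * y, P.mul_mem hx hy, by group⟩

/-- `≤_L` bounds of the form `Δ ^ k` multiply. -/
theorem LeL.zpow_mul (hΔ : IsGarsideElement Δ) {r s : ℤ} {g h : G}
    (hg : LeL P ((Δ : G) ^ r) g) (hh : LeL P ((Δ : G) ^ s) h) :
    LeL P ((Δ : G) ^ (r + s)) (g * h) := by
  obtain ⟨x, hx, rfl⟩ := hg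
  obtain ⟨y, hy, rfl⟩ := hh
  refine ⟨_, P.mul_mem (conj_zpow_mem hΔ s hx) hy, ?_⟩
  rw [zpow_add, zpow_neg]; group

theorem LeL.mul_zpow (hΔ : IsGarsideElement Δ) {r s : ℤ} {g h : G}
    (hg : LeL P g ((Δ : G) ^ r)) (hh : LeL P h ((Δ : G) ^ s)) :
    LeL P (g * h) ((Δ : G) ^ (r + s)) := by
  obtain ⟨x, hx, ex⟩ := hg
  obtain ⟨y, hy, ey⟩ := hh
  refine ⟨_, P.mul_mem hy (conj_zpow_mem hΔ s hx), ?_⟩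
  rw [zpow_add, ← ex, zpow_neg, ← ey]; group

theorem LeL.inv_zpow (hΔ : IsGarsideElement Δ) {s : ℤ} {g : G}
    (hg : LeL P g ((Δ : G) ^ s)) : LeL P ((Δ : G) ^ (-s)) g⁻¹ := by
  obtain ⟨x, hx, ex⟩ := hg
  refine ⟨_, conj_zpow_mem hΔ (-s) hx, ?_⟩
  have : g⁻¹ = x * (Δ : G) ^ (-s) := by rw [zpow_neg, ← ex]; group
  rw [this]; group

theorem LeL.zpow_inv (hΔ : IsGarsideElement Δ) {r : ℤ} {g : G}
    (hg : LeL P ((Δ : G) ^ r) g) : LeL P g⁻¹ ((Δ : G) ^ (-r)) := by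
  obtain ⟨x, hx, rfl⟩ := hg
  refine ⟨_, conj_zpow_mem hΔ (-r) hx, ?_⟩
  group

theorem exists_le_zpow (hG : IsGarsideGroup P) (hΔ : IsGarsideElement Δ) (g : G) :
    ∃ s : ℤ, LeL P g ((Δ : G) ^ s) := by
  have pos : ∀ q : P, ∃ s : ℤ, LeL P (q : G) ((Δ : G) ^ s) := by
    intro q
    have hq : q ∈ Submonoid.closure {b : P | LeDvdL b Δ} := by rw [hΔ.2]; trivial
    induction hq using Submonoid.closure_induction with
    | mem s hs =>
      obtain ⟨t, ht⟩ := hs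
      exact ⟨1, t, t.2, by rw [zpow_one]; exact_mod_cast congrArg Subtype.val ht⟩
    | one => exact ⟨0, 1, P.one_mem, by simp⟩
    | mul x y _ _ hx hy =>
      obtain ⟨r, hr⟩ := hx
      obtain ⟨s, hs⟩ := hy
      exact ⟨r + s, by push_cast; exact hr.mul_zpow hΔ hs⟩
  obtain ⟨a, ha, b, hb, rfl⟩ := hG.fractions g
  obtain ⟨s, hs⟩ := pos ⟨a, ha⟩
  have h0 : LeL P ((Δ : G) ^ (0 : ℤ)) b := ⟨b, hb, by simp⟩
  exact ⟨_, hs.mul_zpow hΔ (h0.zpow_inv hΔ)⟩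

theorem exists_zpow_le (hG : IsGarsideGroup P) (hΔ : IsGarsideElement Δ) (g : G) :
    ∃ r : ℤ, LeL P ((Δ : G) ^ r) g := by
  obtain ⟨s, hs⟩ := exists_le_zpow hG hΔ g⁻¹
  exact ⟨-s, by simpa using hs.inv_zpow hΔ⟩

theorem le_of_zpow_le_zpow [Nontrivial G] (hG : IsGarsideGroup P) (hΔ : IsGarsideElement Δ)
    {r s : ℤ} (h : LeL P ((Δ : G) ^ r) ((Δ : G) ^ s)) : r ≤ s := by
  by_contra hlt
  obtain ⟨c, hc, e⟩ := h
  have anti := hG.garside.lattice_left.2.2.1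
  have unit : ∀ u v : P, u * v = 1 → u = 1 := fun u v huv =>
    anti u 1 ⟨v, huv⟩ ⟨u, one_mul u⟩
  obtain ⟨m, hm⟩ : ∃ m : ℕ, r - s = m + 1 := ⟨(r - s - 1).toNat, by omega⟩
  have hΔ1 : Δ = 1 := by
    apply unit Δ (Δ ^ m * ⟨c, hc⟩)
    apply Subtype.ext
    have hc' : c = (Δ : G) ^ (-(m + 1 : ℤ)) := by
      rw [← hm, neg_sub, sub_eq_neg_add, zpow_add, ← e, zpow_neg]; group
    push_cast
    rw [hc', ← mul_assoc, ← pow_succ', ← zpow_natCast, ← zpow_add]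
    simp
  obtain ⟨g, hg⟩ := exists_ne (1 : G)
  have triv : ∀ q : P, q = 1 := by
    intro q
    have hq : q ∈ Submonoid.closure {b : P | LeDvdL b Δ} := by rw [hΔ.2]; trivial
    induction hq using Submonoid.closure_induction with
    | mem x hx => obtain ⟨t, ht⟩ := hx; exact unit x t (ht.trans hΔ1)
    | one => rfl
    | mul x y _ _ hx hy => rw [hx, hy, one_mul]
  obtain ⟨a, ha, b, hb, rfl⟩ := hG.fractions g
  have h1 : a = 1 := congrArg Subtype.val (triv ⟨a, ha⟩)
  have h2 : b = 1 := congrArg Subtype.val (triv ⟨b, hb⟩)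
  exact hg (by simp [h1, h2])

theorem isGreatest_inf [Nontrivial G] (hG : IsGarsideGroup P) (hΔ : IsGarsideElement Δ) (g : G) :
    IsGreatest {r : ℤ | LeL P ((Δ : G) ^ r) g} (inf P Δ g) := by
  obtain ⟨s, hs⟩ := exists_le_zpow hG hΔ g
  have hb : BddAbove {r : ℤ | LeL P ((Δ : G) ^ r) g} :=
    ⟨s, fun r hr => le_of_zpow_le_zpow hG hΔ (LeL.trans hr hs)⟩
  exact ⟨Int.csSup_mem (exists_zpow_le hG hΔ g) hb, fun r hr => le_csSup hb hr⟩

theorem isLeast_sup [Nontrivial G] (hG : IsGarsideGroup P) (hΔ : IsGarsideElement Δ) (g : G) :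
    IsLeast {s : ℤ | LeL P g ((Δ : G) ^ s)} (sup P Δ g) := by
  obtain ⟨r, hr⟩ := exists_zpow_le hG hΔ g
  have hb : BddBelow {s : ℤ | LeL P g ((Δ : G) ^ s)} :=
    ⟨r, fun s hs => le_of_zpow_le_zpow hG hΔ (LeL.trans hr hs)⟩
  exact ⟨Int.csInf_mem (exists_le_zpow hG hΔ g) hb, fun r hr => csInf_le hb hr⟩

theorem zpow_le_pow (hΔ : IsGarsideElement Δ) {r : ℤ} {g : G}
    (hg : LeL P ((Δ : G) ^ r) g) (n : ℕ) : LeL P ((Δ : G) ^ (n * r)) (g ^ n) := by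
  induction n with
  | zero => exact ⟨1, P.one_mem, by simp⟩
  | succ n ih =>
    rw [pow_succ]
    have := ih.zpow_mul hΔ hg
    convert this using 2
    push_cast; ring

theorem pow_le_zpow (hΔ : IsGarsideElement Δ) {r : ℤ} {g : G}
    (hg : LeL P g ((Δ : G) ^ r)) (n : ℕ) : LeL P (g ^ n) ((Δ : G) ^ (n * r)) := by
  induction n with
  | zero => exact ⟨1, P.one_mem, by simp⟩
  | succ n ih =>
    rw [pow_succ]
    have := ih.mul_zpow hΔ hg
    convert this using 2
    push_cast; ring

theorem le_of_isConj [Nontrivial G] (hG : IsGarsideGroup P) (hΔ : IsGarsideElement Δ) {r s : ℤ}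
    {g h : G} (hc : IsConj g h) (hr : LeL P ((Δ : G) ^ r) h) (hs : LeL P g ((Δ : G) ^ s)) :
    r ≤ s := by
  obtain ⟨x, rfl⟩ := isConj_iff.1 hc
  obtain ⟨u, hu⟩ := exists_zpow_le hG hΔ x
  obtain ⟨v, hv⟩ := exists_zpow_le hG hΔ x⁻¹
  have bound : ∀ n : ℕ, v + n * r + u ≤ n * s := by
    intro n
    have h1 := (hv.zpow_mul hΔ (zpow_le_pow hΔ hr n)).zpow_mul hΔ hu
    have e : x⁻¹ * (x * g * x⁻¹) ^ n * x = g ^ n := by rw [conj_pow]; group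
    rw [e] at h1
    exact le_of_zpow_le_zpow hG hΔ (h1.trans (pow_le_zpow hΔ hs n))
  by_contra hlt
  have h2 := bound ((-(v + u)).toNat + 1)
  have h3 : -(v + u) ≤ ((-(v + u)).toNat : ℤ) := Int.self_le_toNat _
  push_cast at h2
  nlinarith [Int.natCast_nonneg (-(v + u)).toNat]

theorem isGreatest_infS [Nontrivial G] (hG : IsGarsideGroup P) (hΔ : IsGarsideElement Δ) (g : G) :
    IsGreatest {r : ℤ | ∃ h : G, IsConj g h ∧ inf P Δ h = r} (infS P Δ g) := by
  have hb : BddAbove {r : ℤ | ∃ h : G, IsConj g h ∧ inf P Δ h = r} := by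
    refine ⟨sup P Δ g, ?_⟩
    rintro r ⟨h, hc, rfl⟩
    exact le_of_isConj hG hΔ hc (isGreatest_inf hG hΔ h).1 (isLeast_sup hG hΔ g).1
  exact ⟨Int.csSup_mem ⟨_, g, IsConj.refl g, rfl⟩ hb, fun r hr => le_csSup hb hr⟩

theorem isLeast_supS [Nontrivial G] (hG : IsGarsideGroup P) (hΔ : IsGarsideElement Δ) (g : G) :
    IsLeast {s : ℤ | ∃ h : G, IsConj g h ∧ sup P Δ h = s} (supS P Δ g) := by
  have hb : BddBelow {s : ℤ | ∃ h : G, IsConj g h ∧ sup P Δ h = s} := by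
    refine ⟨inf P Δ g, ?_⟩
    rintro r ⟨h, hc, rfl⟩
    exact le_of_isConj hG hΔ hc.symm (isGreatest_inf hG hΔ g).1 (isLeast_sup hG hΔ h).1
  exact ⟨Int.csInf_mem ⟨_, g, IsConj.refl g, rfl⟩ hb, fun r hr => csInf_le hb hr⟩

end Group

end Garside

namespace Garside

section Group

variable {G : Type*} [Group G] {P : Submonoid G} {Δ : P}

/-! Everything rests on `mul_le_infS_pow_iff`: for integral r, n * r ≤ inf_s(g^n) exactly when r ≤
inf_s(g). Taking r = inf_s(g) and r = inf_s(g) + 1 gives the two bounds on inf_s. Passing to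
inverses gives those on sup_s, and subtraction those on len_s.

The hard direction is a fixed-point argument (`exists_conj_zpow_le`). The map φ(y) = g y Δ^(-r) is
an automorphism of the order ≤_L, and Δ^(n r) ≤_L g^n says 1 ≤_L φ^n(1). The meet x of 1, φ(1), ...,
φ^(n-1)(1) therefore satisfies x ≤_L φ(x), which rearranges to Δ^r ≤_L x⁻¹ g x. This needs meets in
all of G, not only in the positive monoid (`exists_glb`). -/

theorem LeL.refl (a : G) : LeL P a a := ⟨1, P.one_mem, mul_one a⟩

theorem LeL.mul_left {a b : G} (h : LeL P a b) (c : G) : LeL P (c * a) (c * b) := by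
  obtain ⟨x, hx, rfl⟩ := h
  exact ⟨x, hx, mul_assoc c a x⟩

/-- Right multiplication by a power of a Garside element preserves `≤_L`. -/
theorem LeL.mul_right_zpow (hΔ : IsGarsideElement Δ) {a b : G} (h : LeL P a b) (k : ℤ) :
    LeL P (a * (Δ : G) ^ k) (b * (Δ : G) ^ k) := by
  obtain ⟨x, hx, rfl⟩ := h
  exact ⟨_, conj_zpow_mem hΔ k hx, by group⟩

theorem zpow_le_zpow (Δ : P) {r s : ℤ} (h : r ≤ s) : LeL P ((Δ : G) ^ r) ((Δ : G) ^ s) := by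
  obtain ⟨m, rfl⟩ := Int.le.dest h
  exact ⟨(Δ : G) ^ m, P.pow_mem Δ.2 m, by rw [zpow_add, zpow_natCast]⟩

/-- Two elements of `G` above `d` have a greatest lower bound among the elements above `d`. -/
theorem exists_glb_above (hG : IsGarsideGroup P) {a b d : G} (ha : LeL P d a) (hb : LeL P d b) :
    ∃ m, LeL P m a ∧ LeL P m b ∧ ∀ c, LeL P d c → LeL P c a → LeL P c b → LeL P c m := by
  obtain ⟨p, hp, rfl⟩ := ha
  obtain ⟨q, hq, rfl⟩ := hb
  obtain ⟨m, ⟨u, hu⟩, ⟨v, hv⟩, hm⟩ := hG.garside.lattice_left.2.2.2.1 ⟨p, hp⟩ ⟨q, hq⟩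
  have hu' : (m : G) * u = p := congrArg Subtype.val hu
  have hv' : (m : G) * v = q := congrArg Subtype.val hv
  refine ⟨d * m, ⟨u, u.2, by rw [mul_assoc, hu']⟩, ⟨v, v.2, by rw [mul_assoc, hv']⟩, ?_⟩
  rintro c ⟨w, hw, rfl⟩ ⟨x, hx, ex⟩ ⟨y, hy, ey⟩
  rw [mul_assoc, mul_right_inj] at ex ey
  obtain ⟨z, hz⟩ := hm ⟨w, hw⟩ ⟨⟨x, hx⟩, Subtype.ext ex⟩ ⟨⟨y, hy⟩, Subtype.ext ey⟩
  have hz' : w * (z : G) = m := congrArg Subtype.val hz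
  exact ⟨z, z.2, by rw [mul_assoc, hz']⟩

/-- Any two elements of a Garside group have a greatest lower bound for `≤_L`. -/
theorem exists_glb (hG : IsGarsideGroup P) (hΔ : IsGarsideElement Δ) (a b : G) :
    ∃ m, LeL P m a ∧ LeL P m b ∧ ∀ c, LeL P c a → LeL P c b → LeL P c m := by
  obtain ⟨i, hi⟩ := exists_zpow_le hG hΔ a
  obtain ⟨j, hj⟩ := exists_zpow_le hG hΔ b
  have hda := (zpow_le_zpow Δ (min_le_left i j)).trans hi
  have hdb := (zpow_le_zpow Δ (min_le_right i j)).trans hj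
  obtain ⟨m, hma, hmb, hm⟩ := exists_glb_above hG hda hdb
  refine ⟨m, hma, hmb, fun c hca hcb => ?_⟩
  -- A lower bound `c` need not lie above the base point used for `m`. Lowering the base point to
  -- fit `c` gives a meet `m'`, and `m'` lies above the old base point because that is itself a
  -- common lower bound; hence `m' ≤_L m`.
  obtain ⟨k, hk⟩ := exists_zpow_le hG hΔ c
  have hkd := zpow_le_zpow Δ (min_le_left (min i j) k)
  obtain ⟨m', hma', hmb', hm'⟩ := exists_glb_above hG (hkd.trans hda) (hkd.trans hdb)
  have hcm' := hm' c ((zpow_le_zpow Δ (min_le_right _ k)).trans hk) hca hcb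
  exact hcm'.trans (hm m' (hm' _ hkd hda hdb) hma' hmb')

theorem exists_glb_range (hG : IsGarsideGroup P) (hΔ : IsGarsideElement Δ) (f : ℕ → G) (n : ℕ) :
    ∃ m, (∀ i ≤ n, LeL P m (f i)) ∧ ∀ c, (∀ i ≤ n, LeL P c (f i)) → LeL P c m := by
  induction n with
  | zero =>
    refine ⟨f 0, fun i hi => ?_, fun c hc => hc 0 le_rfl⟩
    obtain rfl := Nat.le_zero.1 hi
    exact LeL.refl _
  | succ n ih =>
    obtain ⟨m, hm, hmax⟩ := ih
    obtain ⟨x, hxm, hxf, hx⟩ := exists_glb hG hΔ m (f (n + 1))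
    refine ⟨x, fun i hi => ?_, fun c hc =>
      hx c (hmax c fun i hi => hc i (by omega)) (hc (n + 1) le_rfl)⟩
    rcases Nat.of_le_succ hi with h | rfl
    · exact hxm.trans (hm i h)
    · exact hxf

/-- If `Δ ^ (n * r) ≤_L g ^ n` with `n ≥ 1`, then some conjugate of `g` is above `Δ ^ r`.
The conjugator is the meet of the elements `g ^ i * Δ ^ (-i * r)` for `0 ≤ i < n`, which are
permuted up to `≤_L` by the order automorphism `y ↦ g * y * Δ ^ (-r)`. -/
theorem exists_conj_zpow_le (hG : IsGarsideGroup P) (hΔ : IsGarsideElement Δ) {r : ℤ} {g : G}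
    {n : ℕ} (hn : 1 ≤ n) (h : LeL P ((Δ : G) ^ (n * r)) (g ^ n)) :
    ∃ k, IsConj g k ∧ LeL P ((Δ : G) ^ r) k := by
  -- From here the exponent is `n + 1`, so the meet runs over `f 0, ..., f n`.
  obtain ⟨n, rfl⟩ := Nat.exists_eq_add_of_le' hn
  let f : ℕ → G := fun i => g ^ i * (Δ : G) ^ (-(i * r))
  have hf : ∀ i, g⁻¹ * f (i + 1) * (Δ : G) ^ r = f i := by
    intro i
    have e : -(i * r) = -((i + 1 : ℕ) * r) + r := by push_cast; ring
    simp only [f]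
    rw [e, zpow_add, pow_succ']
    group
  obtain ⟨x, hx, hmax⟩ := exists_glb_range hG hΔ f n
  -- The hypothesis closes the cycle: `x ≤_L f 0 = 1 ≤_L f (n + 1)`.
  have hlast : LeL P x (f (n + 1)) := by
    have h0 := h.mul_right_zpow hΔ (-((n + 1 : ℕ) * r))
    rw [← zpow_add, add_neg_cancel, zpow_zero] at h0
    have h1 : LeL P x 1 := by simpa [f] using hx 0 (Nat.zero_le n)
    exact h1.trans h0
  -- The inverse of φ lowers the index of `f` by one, so it sends `x`, which is below `f 1, ..., f
  -- (n + 1)`, to a lower bound of `f 0, ..., f n`.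
  have hle : LeL P (g⁻¹ * x * (Δ : G) ^ r) x := by
    refine hmax _ fun i hi => ?_
    have hxi : LeL P x (f (i + 1)) := by
      rcases hi.eq_or_lt with rfl | hlt
      · exact hlast
      · exact hx _ hlt
    have := (hxi.mul_left g⁻¹).mul_right_zpow hΔ r
    rwa [hf] at this
  refine ⟨x⁻¹ * g * x, isConj_iff.2 ⟨x⁻¹, by rw [inv_inv]⟩, ?_⟩
  have := hle.mul_left (x⁻¹ * g)
  convert this using 1
  group

variable [Nontrivial G]

theorem le_infS_iff (hG : IsGarsideGroup P) (hΔ : IsGarsideElement Δ) {r : ℤ} {g : G} :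
    r ≤ infS P Δ g ↔ ∃ h, IsConj g h ∧ LeL P ((Δ : G) ^ r) h := by
  constructor
  · intro hr
    obtain ⟨h, hc, e⟩ := (isGreatest_infS hG hΔ g).1
    rw [← e] at hr
    exact ⟨h, hc, (zpow_le_zpow Δ hr).trans (isGreatest_inf hG hΔ h).1⟩
  · rintro ⟨h, hc, hr⟩
    exact ((isGreatest_inf hG hΔ h).2 hr).trans ((isGreatest_infS hG hΔ g).2 ⟨h, hc, rfl⟩)

theorem mul_le_infS_pow_iff (hG : IsGarsideGroup P) (hΔ : IsGarsideElement Δ) {r : ℤ} {g : G}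
    {n : ℕ} (hn : 1 ≤ n) : n * r ≤ infS P Δ (g ^ n) ↔ r ≤ infS P Δ g := by
  rw [le_infS_iff hG hΔ, le_infS_iff hG hΔ]
  constructor
  · rintro ⟨h, hc, hr⟩
    -- Each conjugate of `g ^ n` is the `n`th power of a conjugate of `g`.
    obtain ⟨x, rfl⟩ := isConj_iff.1 hc
    rw [← conj_pow] at hr
    obtain ⟨k, hk, hrk⟩ := exists_conj_zpow_le hG hΔ hn hr
    exact ⟨k, (isConj_iff.2 ⟨x, rfl⟩).trans hk, hrk⟩
  · rintro ⟨h, hc, hr⟩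
    exact ⟨h ^ n, hc.pow n, zpow_le_pow hΔ hr n⟩

/-- Since conjugation by Δ preserves `P`, g ≤_L Δ^s is equivalent to Δ^(-s) ≤_L g⁻¹. -/
theorem sup_eq_neg_inf_inv (hG : IsGarsideGroup P) (hΔ : IsGarsideElement Δ) (g : G) :
    sup P Δ g = -inf P Δ g⁻¹ := by
  have h1 := (isGreatest_inf hG hΔ g⁻¹).2 ((isLeast_sup hG hΔ g).1.inv_zpow hΔ)
  have h2 := (isGreatest_inf hG hΔ g⁻¹).1.zpow_inv hΔ
  rw [inv_inv] at h2
  have h3 := (isLeast_sup hG hΔ g).2 h2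
  omega

theorem supS_eq_neg_infS_inv (hG : IsGarsideGroup P) (hΔ : IsGarsideElement Δ) (g : G) :
    supS P Δ g = -infS P Δ g⁻¹ := by
  have hinv : ∀ {a b : G}, IsConj a b → IsConj a⁻¹ b⁻¹ := by
    intro a b h
    obtain ⟨x, rfl⟩ := isConj_iff.1 h
    exact isConj_iff.2 ⟨x, conj_inv.symm⟩
  obtain ⟨h, hc, e⟩ := (isLeast_supS hG hΔ g).1
  obtain ⟨k, hk, e'⟩ := (isGreatest_infS hG hΔ g⁻¹).1
  have h1 := (isGreatest_infS hG hΔ g⁻¹).2 ⟨_, hinv hc, rfl⟩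
  have h2 := (isLeast_supS hG hΔ g).2 ⟨k⁻¹, by simpa using hinv hk, rfl⟩
  rw [sup_eq_neg_inf_inv hG hΔ] at e h2
  rw [inv_inv] at h2
  omega

theorem infS_pow_div_bounds (hG : IsGarsideGroup P) (hΔ : IsGarsideElement Δ) (g : G) {n : ℕ}
    (hn : 1 ≤ n) :
    (infS P Δ g : ℚ) ≤ (infS P Δ (g ^ n) : ℚ) / n ∧
      (infS P Δ (g ^ n) : ℚ) / n < (infS P Δ g : ℚ) + 1 := by
  have hn' : (0 : ℚ) < n := by exact_mod_cast hn
  have lower := (mul_le_infS_pow_iff hG hΔ (g := g) hn).2 le_rfl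
  have upper := lt_of_not_ge (mt (mul_le_infS_pow_iff hG hΔ (g := g) hn).1
    (lt_add_one (infS P Δ g)).not_ge)
  rw [le_div_iff₀ hn', div_lt_iff₀ hn', mul_comm, mul_comm _ (n : ℚ)]
  exact ⟨by exact_mod_cast lower, by exact_mod_cast upper⟩

theorem supS_pow_div_bounds (hG : IsGarsideGroup P) (hΔ : IsGarsideElement Δ) (g : G) {n : ℕ}
    (hn : 1 ≤ n) :
    (supS P Δ g : ℚ) - 1 < (supS P Δ (g ^ n) : ℚ) / n ∧
      (supS P Δ (g ^ n) : ℚ) / n ≤ (supS P Δ g : ℚ) := by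
  obtain ⟨h1, h2⟩ := infS_pow_div_bounds hG hΔ g⁻¹ hn
  rw [supS_eq_neg_infS_inv hG hΔ, supS_eq_neg_infS_inv hG hΔ, ← inv_pow]
  push_cast
  rw [neg_div]
  constructor <;> linarith

end Group

end Garside

theorem theorem6p1 {G : Type*} [Group G] [Nontrivial G] (P : Submonoid G)
    (hG : Garside.IsGarsideGroup P) (Δ : P) (hΔ : Garside.IsGarsideElement Δ)
    (g : G) (n : ℕ) (hn : 1 ≤ n) :
    ((Garside.infS P Δ g : ℚ) ≤ (Garside.infS P Δ (g ^ n) : ℚ) / n ∧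
      (Garside.infS P Δ (g ^ n) : ℚ) / n < (Garside.infS P Δ g : ℚ) + 1) ∧
    ((Garside.supS P Δ g : ℚ) - 1 < (Garside.supS P Δ (g ^ n) : ℚ) / n ∧
      (Garside.supS P Δ (g ^ n) : ℚ) / n ≤ (Garside.supS P Δ g : ℚ)) ∧
    ((Garside.lenS P Δ g : ℚ) - 2 < (Garside.lenS P Δ (g ^ n) : ℚ) / n ∧
      (Garside.lenS P Δ (g ^ n) : ℚ) / n ≤ (Garside.lenS P Δ g : ℚ)) := by
  have hinf := Garside.infS_pow_div_bounds hG hΔ g hn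
  have hsup := Garside.supS_pow_div_bounds hG hΔ g hn
  refine ⟨hinf, hsup, ?_⟩
  obtain ⟨h1, h2⟩ := hinf
  obtain ⟨h3, h4⟩ := hsup
  -- The inf_s and sup_s bounds each lose less than 1, whence the 2.
  simp only [Garside.lenS, Int.cast_sub, sub_div]
  constructor <;> linarith
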